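/- For a compact set $E\subset\mathbb{C}$, let $\Omega=(\mathbb{C}\cup\{\infty\})\setminus E$ be its complement in the Riemann sphere, and define the analytic capacity of $E$ by $$\gamma(E):=\sup\{|f'(\infty)| : f \text{ analytic on } \Omega,\ |f|\le 1 \text{ on } \Omega\},\qquad f'(\infty):=\lim_{z\to\infty} z\,(f(z)-f(\infty)).$$ **Theorem.** The following two assertions are equivalent. 1. Analytic capacity is subadditive: $\gamma(E\cup F)\le\gamma(E)+\gamma(F)$ for all compact sets $E,F\subset\mathbb{C}$. 2. For every $r>0$, the inequality $\gamma(E\cup F)\le\gamma(E)+\gamma(F)$ holds for all disjoint sets $E,F\subset\mathbb{C}$ each of which is a union of finitely many pairwise disjoint closed disks of radius $r$ (the same $r$ for all the disks of $E$ and of $F$). -/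

import Mathlib

open scoped OnePoint

noncomputable section

namespace AnalyticCapacity

/-- The complement of `E` in the Riemann sphere `ℂ ∪ {∞}`. -/
def sphereCompl (E : Set ℂ) : Set (OnePoint ℂ) :=
  (((↑) : ℂ → OnePoint ℂ) '' E)ᶜ

/-- A function on the Riemann sphere, read in the coordinate `w = 1/z` centred at `∞`. -/
def atInftyChart (f : OnePoint ℂ → ℂ) (w : ℂ) : ℂ :=
  if w = 0 then f ∞ else f ((w⁻¹ : ℂ) : OnePoint ℂ)

/-- `f` is analytic on the complement of the compact set `E` in the Riemann sphere: it is analytic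
at each point of `ℂ \ E` and, in the coordinate `1/z`, at `∞`.
(The values of `f` at points of `E` are irrelevant.) -/
def IsAnalyticOff (E : Set ℂ) (f : OnePoint ℂ → ℂ) : Prop :=
  AnalyticOnNhd ℂ (fun z : ℂ => f (z : OnePoint ℂ)) Eᶜ ∧ AnalyticAt ℂ (atInftyChart f) 0

/-- `f'(∞) = a`, that is, `z (f(z) - f(∞)) → a` as `z → ∞`. -/
def HasDerivAtInfty (f : OnePoint ℂ → ℂ) (a : ℂ) : Prop :=
  Filter.Tendsto (fun z : ℂ => z * (f (z : OnePoint ℂ) - f ∞)) (Bornology.cobounded ℂ) (nhds a)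

/-- All the numbers `|f'(∞)|`, for `f` analytic on the complement of `E` in the Riemann sphere
with `|f| ≤ 1` there. -/
def competitorValues (E : Set ℂ) : Set ℝ :=
  {t : ℝ | ∃ (f : OnePoint ℂ → ℂ) (a : ℂ), IsAnalyticOff E f ∧
    (∀ p ∈ sphereCompl E, ‖f p‖ ≤ 1) ∧ HasDerivAtInfty f a ∧ t = ‖a‖}

/-- The analytic capacity `γ(E)` of a compact set `E ⊆ ℂ`. -/
def gamma (E : Set ℂ) : ℝ :=
  sSup (competitorValues E)

/-- `E` is the union of finitely many pairwise disjoint closed disks of radius `r`. -/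
def IsFiniteUnionOfDisks (r : ℝ) (E : Set ℂ) : Prop :=
  ∃ Z : Finset ℂ, (Z : Set ℂ).PairwiseDisjoint (fun z => Metric.closedBall z r) ∧
    E = ⋃ z ∈ Z, Metric.closedBall z r

end AnalyticCapacity

end

noncomputable section

namespace AnalyticCapacity

open Filter Topology Metric Set Bornology MeasureTheory

/-! Finite unions of disks are compact, so only the passage from disks to compact sets needs an
argument. It squeezes `gamma (E ∪ F)` between two approximations.

From above, normal families give outer regularity (`exists_gamma_cthickening_le`): small closed
thickenings of a compact set have almost the same capacity.

From below, `exists_disks` turns a competitor `f` for K = E ∪ F into one for disjoint disks of one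
radius r near K. A cutoff makes `f` a smooth function g, and Cauchy–Pompeiu writes g as f(∞) plus
the Cauchy transform of the density (∂̄g)/π, which is supported near K (`exists_density`). Moving
this mass to grid points keeps the total, hence f'(∞), and changes the transform by O(√r) at
distance at least r from those points (`exists_norm_integral_sub_le`). The result is a rational
function bounded by 1 + η off the disks.

Each disk is close to E or to F. Sorting them accordingly gives two disjoint families even when E
and F overlap; the hypothesis on disks, monotonicity and outer regularity then conclude. -/

/-! ### Pointwise limits of bounded holomorphic functions -/

/-- A family of holomorphic functions bounded by one on an open set which converges pointwise
converges locally uniformly. -/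
theorem tendstoLocallyUniformlyOn_of_bounded {ι : Type*} {l : Filter ι} {F : ι → ℂ → ℂ} {G : ℂ → ℂ}
    {U : Set ℂ} (hU : IsOpen U) [l.NeBot] (hF : ∀ᶠ n in l, DifferentiableOn ℂ (F n) U)
    (hb : ∀ᶠ n in l, ∀ z ∈ U, ‖F n z‖ ≤ 1)
    (hlim : ∀ z ∈ U, Tendsto (fun n => F n z) l (𝓝 (G z))) :
    TendstoLocallyUniformlyOn F G l U := by
  rw [Metric.tendstoLocallyUniformlyOn_iff]
  intro ε hε x hx
  obtain ⟨ρ, hρ, hρU⟩ := Metric.isOpen_iff.1 hU x hx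
  -- Schwarz lemma: the values on the ball differ from the central one by at most 2, so all `F n`
  -- share the constant 2 / ρ. With radius ρε/6 below, each oscillation is less than ε/3.
  have key : ∀ᶠ n in l, ∀ y ∈ ball x ρ, dist (F n y) (F n x) ≤ 2 / ρ * dist y x := by
    filter_upwards [hF, hb] with n hn hbn y hy
    refine Complex.dist_le_div_mul_dist_of_mapsTo_ball (hn.mono hρU) (fun z hz => ?_) hy
    have h1 := hbn z (hρU hz)
    have h2 := hbn x hx
    rw [mem_closedBall, dist_eq_norm]
    exact (norm_sub_le _ _).trans (by linarith)
  have hG : ∀ y ∈ ball x ρ, dist (G y) (G x) ≤ 2 / ρ * dist y x := fun y hy =>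
    le_of_tendsto ((hlim y (hρU hy)).dist (hlim x hx)) (key.mono fun n hn => hn y hy)
  refine ⟨ball x (min ρ (ρ * ε / 6)), mem_nhdsWithin_of_mem_nhds
    (ball_mem_nhds _ (by positivity)), ?_⟩
  filter_upwards [key, (Metric.tendsto_nhds.1 (hlim x hx)) (ε / 3) (by positivity)] with n hn hd y hy
  have hyρ : y ∈ ball x ρ := ball_subset_ball (min_le_left _ _) hy
  have hy2 : 2 / ρ * dist y x < ε / 3 := by
    have : dist y x < ρ * ε / 6 := lt_of_lt_of_le hy (min_le_right _ _)
    calc 2 / ρ * dist y x < 2 / ρ * (ρ * ε / 6) := by gcongr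
      _ = ε / 3 := by field_simp; norm_num
  have h1 := hn y hyρ
  have h2 := hG y hyρ
  rw [dist_comm] at hd
  have h3 := dist_triangle4 (G y) (G x) (F n x) (F n y)
  rw [dist_comm (F n x) (F n y)] at h3
  linarith

/-! ### The chart at infinity -/

/-- With w = 1/z, the difference quotient of the chart at 0 is exactly z (f(z) - f(∞)). -/
theorem hasDerivAtInfty_iff {f : OnePoint ℂ → ℂ} {a : ℂ} :
    HasDerivAtInfty f a ↔ HasDerivAt (atInftyChart f) a 0 := by
  rw [hasDerivAt_iff_tendsto_slope, HasDerivAtInfty]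
  have key : ∀ z : ℂ, z ≠ 0 →
      slope (atInftyChart f) 0 z = z⁻¹ * (f ((z⁻¹ : ℂ) : OnePoint ℂ) - f ∞) := by
    intro z hz
    simp [slope, atInftyChart, hz]
  constructor
  · intro h
    refine (h.comp tendsto_inv₀_nhdsNE_zero).congr' ?_
    filter_upwards [self_mem_nhdsWithin] with z hz
    exact (key z hz).symm
  · intro h
    refine (h.comp tendsto_inv₀_cobounded').congr' ?_
    filter_upwards [hasBasis_cobounded_norm.mem_of_mem (i := 1) trivial] with z hz
    have hz0 : z ≠ 0 := by
      rintro rfl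
      norm_num at hz
    simp only [Function.comp, key _ (inv_ne_zero hz0), inv_inv]

theorem atInftyChart_zero (f : OnePoint ℂ → ℂ) : atInftyChart f 0 = f ∞ := by simp [atInftyChart]

theorem atInftyChart_of_ne (f : OnePoint ℂ → ℂ) {w : ℂ} (hw : w ≠ 0) :
    atInftyChart f w = f ((w⁻¹ : ℂ) : OnePoint ℂ) := by simp [atInftyChart, hw]

theorem infty_mem_sphereCompl (E : Set ℂ) : ∞ ∈ sphereCompl E := by simp [sphereCompl]

theorem coe_mem_sphereCompl {E : Set ℂ} {z : ℂ} : (z : OnePoint ℂ) ∈ sphereCompl E ↔ z ∉ E := by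
  simp [sphereCompl]

theorem inv_notMem_of_mem_ball {E : Set ℂ} {R : ℝ} (hR : 0 < R) (hE : E ⊆ closedBall 0 R) {w : ℂ}
    (hw : w ∈ ball (0 : ℂ) R⁻¹) (h0 : w ≠ 0) : w⁻¹ ∉ E := by
  intro h
  have h1 := hE h
  rw [mem_closedBall_zero_iff, norm_inv] at h1
  rw [mem_ball_zero_iff] at hw
  have h2 : 0 < ‖w‖ := norm_pos_iff.2 h0
  rw [inv_le_comm₀ h2 hR] at h1
  linarith

theorem norm_atInftyChart_le {E : Set ℂ} {R : ℝ} (hR : 0 < R) (hE : E ⊆ closedBall 0 R)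
    {f : OnePoint ℂ → ℂ} (hf : ∀ p ∈ sphereCompl E, ‖f p‖ ≤ 1) {w : ℂ}
    (hw : w ∈ ball (0 : ℂ) R⁻¹) : ‖atInftyChart f w‖ ≤ 1 := by
  by_cases h0 : w = 0
  · rw [h0, atInftyChart_zero]
    exact hf _ (infty_mem_sphereCompl E)
  · rw [atInftyChart_of_ne f h0]
    exact hf _ (coe_mem_sphereCompl.2 (inv_notMem_of_mem_ball hR hE hw h0))

theorem IsAnalyticOff.differentiableOn_atInftyChart {E : Set ℂ} {R : ℝ} (hR : 0 < R)
    (hE : E ⊆ closedBall 0 R) {f : OnePoint ℂ → ℂ} (hf : IsAnalyticOff E f) :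
    DifferentiableOn ℂ (atInftyChart f) (ball 0 R⁻¹) := by
  intro w hw
  refine DifferentiableAt.differentiableWithinAt ?_
  by_cases h0 : w = 0
  · rw [h0]
    exact hf.2.differentiableAt
  · have h1 : DifferentiableAt ℂ (fun z : ℂ => f (z : OnePoint ℂ)) w⁻¹ :=
      (hf.1 _ (inv_notMem_of_mem_ball hR hE hw h0)).differentiableAt
    refine (h1.comp w (differentiableAt_inv h0)).congr_of_eventuallyEq ?_
    filter_upwards [isOpen_ne.mem_nhds h0] with z hz
    exact atInftyChart_of_ne f hz

/-! ### Elementary properties of the analytic capacity -/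

/-- Schwarz lemma in the chart at infinity; without this bound the `sSup` in `gamma` would carry no
information. -/
theorem bddAbove_competitorValues {E : Set ℂ} (hE : IsBounded E) :
    BddAbove (competitorValues E) := by
  obtain ⟨R, hR, hER⟩ := hE.subset_closedBall_lt 0 0
  refine ⟨2 / R⁻¹, ?_⟩
  rintro t ⟨f, a, hf, hb, ha, rfl⟩
  rw [← (hasDerivAtInfty_iff.1 ha).deriv]
  refine Complex.norm_deriv_le_div_of_mapsTo_ball (hf.differentiableOn_atInftyChart hR hER)
    (fun z hz => ?_) (by positivity)
  have h1 := norm_atInftyChart_le hR hER hb hz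
  have h2 := norm_atInftyChart_le hR hER hb (mem_ball_self (inv_pos.2 hR))
  rw [mem_closedBall, dist_eq_norm]
  exact (norm_sub_le _ _).trans (by linarith)

theorem competitorValues_nonempty (E : Set ℂ) : (competitorValues E).Nonempty := by
  have h : atInftyChart (fun _ => 0) = fun _ => 0 := by
    ext w
    simp [atInftyChart]
  refine ⟨0, fun _ => 0, 0, ⟨analyticOnNhd_const, ?_⟩, by simp, ?_, by simp⟩
  · rw [h]
    exact analyticAt_const
  · simp [HasDerivAtInfty]

theorem norm_le_gamma {E : Set ℂ} (hE : IsBounded E) {f : OnePoint ℂ → ℂ} {a : ℂ}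
    (hf : IsAnalyticOff E f) (hb : ∀ p ∈ sphereCompl E, ‖f p‖ ≤ 1) (ha : HasDerivAtInfty f a) :
    ‖a‖ ≤ gamma E :=
  le_csSup (bddAbove_competitorValues hE) ⟨f, a, hf, hb, ha, rfl⟩

theorem competitorValues_mono {E F : Set ℂ} (h : E ⊆ F) :
    competitorValues E ⊆ competitorValues F := by
  rintro t ⟨f, a, hf, hb, ha, rfl⟩
  exact ⟨f, a, ⟨hf.1.mono (compl_subset_compl.2 h), hf.2⟩,
    fun p hp => hb p fun hpE => hp (image_mono h hpE), ha, rfl⟩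

theorem gamma_mono {E F : Set ℂ} (h : E ⊆ F) (hF : IsBounded F) : gamma E ≤ gamma F :=
  csSup_le_csSup (bddAbove_competitorValues hF) (competitorValues_nonempty E)
    (competitorValues_mono h)

/-! ### Normal families and outer regularity -/

/-- A limit, along an ultrafilter, of competitors for shrinking neighbourhoods of `E` is a
competitor for `E`. -/
theorem exists_limit_competitor {ι : Type*} (l : Ultrafilter ι) {E : Set ℂ} {R : ℝ} (hR : 0 < R)
    {D : ι → Set ℂ} (hED : ∀ z ∉ E, ∃ ρ > 0, ∀ᶠ n in l, Disjoint (ball z ρ) (D n))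
    (hEsub : ∀ n, E ⊆ D n) (hD : ∀ n, D n ⊆ closedBall 0 R)
    {f : ι → OnePoint ℂ → ℂ} {a : ι → ℂ} (hf : ∀ n, IsAnalyticOff (D n) (f n))
    (hb : ∀ n, ∀ p ∈ sphereCompl (D n), ‖f n p‖ ≤ 1) (ha : ∀ n, HasDerivAtInfty (f n) (a n)) :
    ∃ g b, IsAnalyticOff E g ∧ (∀ p ∈ sphereCompl E, ‖g p‖ ≤ 1) ∧ HasDerivAtInfty g b ∧
      Tendsto a l (𝓝 b) := by
  obtain ⟨k⟩ := l.neBot.nonempty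
  have hER := (hEsub k).trans (hD k)
  have hev : ∀ p ∈ sphereCompl E, ∀ᶠ n in l, ‖f n p‖ ≤ 1 := by
    intro p hp
    induction p using OnePoint.rec with
    | infty => exact Eventually.of_forall fun n => hb n _ (infty_mem_sphereCompl _)
    | coe z =>
      obtain ⟨ρ, hρ, h⟩ := hED z (coe_mem_sphereCompl.1 hp)
      filter_upwards [h] with n hn
      exact hb n _ (coe_mem_sphereCompl.2 (hn.notMem_of_mem_left (mem_ball_self hρ)))
  -- Compactness of the unit disk gives a limit along the ultrafilter at every point at once, with
  -- no diagonal subsequence. Points of E get the irrelevant value 0.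
  have hlim : ∀ p, ∃ c : ℂ, p ∈ sphereCompl E →
      ‖c‖ ≤ 1 ∧ Tendsto (fun n => f n p) l (𝓝 c) := by
    intro p
    by_cases hp : p ∈ sphereCompl E
    · obtain ⟨c, hc, hlc⟩ := (isCompact_closedBall (0 : ℂ) 1).ultrafilter_le_nhds
        (l.map fun n => f n p) (by
          rw [le_principal_iff]
          refine mem_map.2 ?_
          filter_upwards [hev p hp] with n hn
          simpa using hn)
      exact ⟨c, fun _ => ⟨by simpa using hc, hlc⟩⟩
    · exact ⟨0, fun h => absurd h hp⟩
  choose g hg using hlim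
  have hchart : ∀ z ∈ ball (0 : ℂ) R⁻¹,
      Tendsto (fun n => atInftyChart (f n) z) l (𝓝 (atInftyChart g z)) := by
    intro z hz
    by_cases h0 : z = 0
    · simp only [h0, atInftyChart_zero]
      exact (hg _ (infty_mem_sphereCompl E)).2
    · simp only [atInftyChart_of_ne _ h0]
      exact (hg _ (coe_mem_sphereCompl.2 (inv_notMem_of_mem_ball hR hER hz h0))).2
  have hdiff : ∀ᶠ n in (l : Filter ι), DifferentiableOn ℂ (atInftyChart (f n)) (ball 0 R⁻¹) :=
    Eventually.of_forall fun n => (hf n).differentiableOn_atInftyChart hR (hD n)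
  have hloc := tendstoLocallyUniformlyOn_of_bounded isOpen_ball hdiff
    (Eventually.of_forall fun n z hz => norm_atInftyChart_le hR (hD n) (hb n) hz) hchart
  have h0 : (0 : ℂ) ∈ ball (0 : ℂ) R⁻¹ := mem_ball_self (inv_pos.2 hR)
  have hdg := hloc.differentiableOn hdiff isOpen_ball
  have hgan : AnalyticAt ℂ (atInftyChart g) 0 := hdg.analyticAt (isOpen_ball.mem_nhds h0)
  refine ⟨g, deriv (atInftyChart g) 0, ⟨fun z hz => ?_, hgan⟩, fun p hp => (hg p hp).1,
    hasDerivAtInfty_iff.2 hgan.differentiableAt.hasDerivAt, ?_⟩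
  · obtain ⟨ρ, hρ, h⟩ := hED z hz
    obtain ⟨m, hm⟩ := h.exists
    have hEd : ∀ w ∈ ball z ρ, w ∉ E := fun w hw hwE =>
      hm.notMem_of_mem_left hw (hEsub m hwE)
    have hd : ∀ᶠ n in (l : Filter ι),
        DifferentiableOn ℂ (fun w : ℂ => f n (w : OnePoint ℂ)) (ball z ρ) := by
      filter_upwards [h] with n hn w hw
      exact ((hf n).1 w (hn.notMem_of_mem_left hw)).differentiableAt.differentiableWithinAt
    have := tendstoLocallyUniformlyOn_of_bounded (l := (l : Filter ι)) isOpen_ball hd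
      (by
        filter_upwards [h] with n hn w hw
        exact hb n _ (coe_mem_sphereCompl.2 (hn.notMem_of_mem_left hw)))
      (G := fun w : ℂ => g (w : OnePoint ℂ))
      (fun w hw => (hg _ (coe_mem_sphereCompl.2 (hEd w hw))).2)
    exact (this.differentiableOn hd isOpen_ball).analyticAt (ball_mem_nhds _ hρ)
  · refine ((hloc.deriv hdiff isOpen_ball).tendsto_at h0).congr fun n => ?_
    exact (hasDerivAtInfty_iff.1 (ha n)).deriv

/-- Analytic capacity is outer regular on compact sets. -/
theorem exists_gamma_cthickening_le {E : Set ℂ} (hE : IsCompact E) {ε : ℝ} (hε : 0 < ε) :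
    ∃ δ > 0, gamma (cthickening δ E) ≤ gamma E + ε := by
  -- Otherwise the thickenings of radius 1/(n+1) have competitors with derivative above γ(E) + ε,
  -- and a limit of these is a competitor for E.
  by_contra! hcon
  obtain ⟨R, hR, hER⟩ := (hE.isBounded.cthickening (δ := 1)).subset_closedBall_lt 0 0
  have hδ : ∀ n : ℕ, (0 : ℝ) < 1 / ((n : ℝ) + 1) := fun n => Nat.one_div_pos_of_nat
  have hex : ∀ n : ℕ, ∃ t ∈ competitorValues (cthickening (1 / ((n : ℝ) + 1)) E),
      gamma E + ε < t := fun n =>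
    exists_lt_of_lt_csSup (competitorValues_nonempty _) (hcon _ (hδ n))
  choose t ht hlt using hex
  choose f a hf hb ha hta using ht
  have hsep : ∀ z ∉ E, ∃ ρ > 0, ∀ᶠ n : ℕ in (hyperfilter ℕ : Filter ℕ),
      Disjoint (ball z ρ) (cthickening (1 / ((n : ℝ) + 1)) E) := by
    intro z hz
    obtain ⟨d, hd, hdz⟩ := Metric.isOpen_iff.1 hE.isClosed.isOpen_compl z hz
    refine ⟨d / 2, by positivity, ?_⟩
    have : ∀ᶠ n : ℕ in atTop, 1 / ((n : ℝ) + 1) < d / 2 :=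
      (tendsto_order.1 tendsto_one_div_add_atTop_nhds_zero_nat).2 _ (by positivity)
    have h2 := this.filter_mono (Nat.hyperfilter_le_atTop)
    filter_upwards [h2] with n hn
    rw [Set.disjoint_left]
    intro w hw hwE
    have h3 : w ∈ thickening (d / 2) E := cthickening_subset_thickening' (by positivity) hn E hwE
    obtain ⟨y, hy, hwy⟩ := mem_thickening_iff.1 h3
    refine hdz ?_ hy
    rw [mem_ball] at hw ⊢
    have h4 := dist_triangle y w z
    rw [dist_comm y w] at h4
    linarith
  obtain ⟨g, b, hg, hgb, hgd, hlim⟩ := exists_limit_competitor (hyperfilter ℕ) (E := E) hR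
    (D := fun n : ℕ => cthickening (1 / ((n : ℝ) + 1)) E) hsep
    (fun n => self_subset_cthickening E) (fun n => (cthickening_mono (by
      rw [div_le_one (by positivity)]
      linarith [n.cast_nonneg (α := ℝ)]) E).trans hER)
    hf hb ha
  have h1 := norm_le_gamma hE.isBounded hg hgb hgd
  have h2 : gamma E + ε ≤ ‖b‖ := ge_of_tendsto hlim.norm
    (Eventually.of_forall fun n => by
      rw [← hta n]
      exact (hlt n).le)
  linarith

/-! ### The Cauchy–Pompeiu formula -/

/-- The Wirtinger derivative `∂g/∂z̄`. -/
def dbar (g : ℂ → ℂ) (w : ℂ) : ℂ :=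
  (1 / 2) * (fderiv ℝ g w 1 + Complex.I * fderiv ℝ g w Complex.I)

theorem continuous_dbar {g : ℂ → ℂ} (hg : ContDiff ℝ 1 g) : Continuous (dbar g) := by
  have h : Continuous (fderiv ℝ g) := hg.continuous_fderiv one_ne_zero
  unfold dbar
  fun_prop

theorem dbar_eq_zero_of_differentiableAt {g : ℂ → ℂ} {w : ℂ} (h : DifferentiableAt ℂ g w) :
    dbar g w = 0 := by
  rw [dbar, h.fderiv_restrictScalars ℝ]
  have : fderiv ℂ g w Complex.I = Complex.I * fderiv ℂ g w 1 := by
    rw [← smul_eq_mul, ← map_smul, smul_eq_mul, mul_one]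
  simp only [ContinuousLinearMap.coe_restrictScalars', this]
  linear_combination (1 / 2 * fderiv ℂ g w 1) * Complex.I_mul_I

theorem dbar_comp_add (g : ℂ → ℂ) (z w : ℂ) : dbar (fun u => g (u + z)) w = dbar g (w + z) := by
  simp only [dbar, fderiv_comp_add_right]

/-- The unit circle parametrized by the angle. -/
def unitCircle (θ : ℝ) : ℂ := Complex.exp (θ * Complex.I)

theorem continuous_unitCircle : Continuous unitCircle := by
  unfold unitCircle
  fun_prop

theorem hasDerivAt_unitCircle (θ : ℝ) :
    HasDerivAt unitCircle (Complex.I * unitCircle θ) θ := by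
  have h1 : HasDerivAt (fun t : ℝ => (t : ℂ) * Complex.I) (1 * Complex.I) θ :=
    (Complex.ofRealCLM.hasDerivAt (x := θ)).mul_const Complex.I
  convert! h1.cexp using 1
  rw [unitCircle]
  ring

/-- In polar coordinates ∂̄ = (e^{iθ}/2)(∂_r + (i/r)∂_θ), and the Jacobian r cancels the pole of
1/w. -/
theorem dbar_mul_inv_eq (g : ℂ → ℂ) {r : ℝ} (hr : r ≠ 0) (θ : ℝ) :
    r • (dbar g (r * unitCircle θ) / (r * unitCircle θ)) =
      (1 / 2) * (fderiv ℝ g (r * unitCircle θ) (unitCircle θ) +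
        Complex.I * fderiv ℝ g (r * unitCircle θ) (Complex.I * unitCircle θ)) := by
  have he : unitCircle θ ≠ 0 := Complex.exp_ne_zero _
  have hr' : (r : ℂ) ≠ 0 := Complex.ofReal_ne_zero.2 hr
  have e1 : unitCircle θ = (Real.cos θ) • (1 : ℂ) + (Real.sin θ) • Complex.I := by
    simp [unitCircle, Complex.exp_mul_I]
  have e2 : Complex.I * unitCircle θ = (Real.cos θ) • Complex.I + (-Real.sin θ) • (1 : ℂ) := by
    rw [e1]
    simp only [Complex.real_smul, Complex.ofReal_neg]
    linear_combination (Real.sin θ : ℂ) * Complex.I_mul_I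
  set L := fderiv ℝ g (r * unitCircle θ) with hL
  have hcs : (Real.cos θ : ℂ) ^ 2 + (Real.sin θ : ℂ) ^ 2 = 1 := by
    exact_mod_cast Real.cos_sq_add_sin_sq θ
  have l1 : L (unitCircle θ) = Real.cos θ * L 1 + Real.sin θ * L Complex.I := by
    rw [e1, map_add, map_smul, map_smul]
    simp
  have l2 : L (Complex.I * unitCircle θ) = Real.cos θ * L Complex.I - Real.sin θ * L 1 := by
    rw [e2, map_add, map_smul, map_smul]
    simp [sub_eq_add_neg]
  rw [l1, l2, dbar, ← hL, Complex.real_smul]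
  rw [mul_div_assoc', mul_div_mul_left _ _ hr', div_eq_iff he, e1]
  simp only [Complex.real_smul]
  linear_combination (-(1 / 2) * (L 1 + Complex.I * L Complex.I)) * hcs +
    (1/2) * ((Real.sin θ : ℂ)^2 * L 1 - Real.sin θ * Real.cos θ * L Complex.I) * Complex.I_mul_I

theorem integral_radial_derivative {g : ℂ → ℂ} (hg : ContDiff ℝ 1 g) (ρ θ : ℝ) :
    ∫ r in (0 : ℝ)..ρ, fderiv ℝ g (r * unitCircle θ) (unitCircle θ) =
      g (ρ * unitCircle θ) - g 0 := by
  have hd : ∀ r : ℝ, HasDerivAt (fun r : ℝ => g (r * unitCircle θ))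
      (fderiv ℝ g (r * unitCircle θ) (unitCircle θ)) r := by
    intro r
    have h1 : HasDerivAt (fun t : ℝ => (t : ℂ) * unitCircle θ) (1 * unitCircle θ) r :=
      (Complex.ofRealCLM.hasDerivAt (x := r)).mul_const _
    rw [one_mul] at h1
    exact ((hg.differentiable one_ne_zero _).hasFDerivAt).comp_hasDerivAt r h1
  have hc : Continuous fun r : ℝ => fderiv ℝ g (r * unitCircle θ) (unitCircle θ) := by
    have h : Continuous (fderiv ℝ g) := hg.continuous_fderiv one_ne_zero
    fun_prop
  rw [intervalIntegral.integral_eq_sub_of_hasDerivAt (fun r _ => hd r)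
    (hc.intervalIntegrable _ _)]
  simp

theorem integral_angular_derivative {g : ℂ → ℂ} (hg : ContDiff ℝ 1 g) {r : ℝ} (hr : r ≠ 0) :
    ∫ θ in (-Real.pi)..Real.pi,
      fderiv ℝ g (r * unitCircle θ) (Complex.I * unitCircle θ) = 0 := by
  have hd : ∀ θ : ℝ, HasDerivAt (fun θ : ℝ => r⁻¹ • g (r * unitCircle θ))
      (fderiv ℝ g (r * unitCircle θ) (Complex.I * unitCircle θ)) θ := by
    intro θ
    have h1 : HasDerivAt (fun t : ℝ => (r : ℂ) * unitCircle t)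
        (r * (Complex.I * unitCircle θ)) θ := (hasDerivAt_unitCircle θ).const_mul _
    have h2 := ((((hg.differentiable one_ne_zero _).hasFDerivAt).comp_hasDerivAt θ h1)).const_smul
      r⁻¹
    have h3 : r⁻¹ • fderiv ℝ g (r * unitCircle θ) (r * (Complex.I * unitCircle θ)) =
        fderiv ℝ g (r * unitCircle θ) (Complex.I * unitCircle θ) := by
      rw [← Complex.real_smul (z := Complex.I * unitCircle θ), map_smul, smul_smul,
        inv_mul_cancel₀ hr, one_smul]
    rw [h3] at h2
    exact h2
  have hc : Continuous fun θ : ℝ =>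
      fderiv ℝ g (r * unitCircle θ) (Complex.I * unitCircle θ) := by
    have h : Continuous (fderiv ℝ g) := hg.continuous_fderiv one_ne_zero
    have := continuous_unitCircle
    fun_prop
  rw [intervalIntegral.integral_eq_sub_of_hasDerivAt (fun r _ => hd r)
    (hc.intervalIntegrable _ _)]
  simp [unitCircle, Complex.exp_neg, Complex.exp_pi_mul_I]

/-- The radial part integrates along rays to boundary values minus g(0); the angular part is the
derivative of a periodic function and integrates to zero. -/
theorem integral_dbar_div {g : ℂ → ℂ} (hg : ContDiff ℝ 1 g) {ρ : ℝ} (hρ : 0 ≤ ρ)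
    (h0 : ∀ w, ρ ≤ ‖w‖ → dbar g w = 0) :
    ∫ w, dbar g w / w =
      (1 / 2) * (∫ θ in (-Real.pi)..Real.pi, g (ρ * unitCircle θ)) - Real.pi * g 0 := by
  have hfd : Continuous (fderiv ℝ g) := hg.continuous_fderiv one_ne_zero
  have hu := continuous_unitCircle
  set A : ℝ × ℝ → ℂ := fun p => fderiv ℝ g (p.1 * unitCircle p.2) (unitCircle p.2) with hA
  set B : ℝ × ℝ → ℂ := fun p => fderiv ℝ g (p.1 * unitCircle p.2) (Complex.I * unitCircle p.2)
    with hB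
  have hAc : Continuous A := by fun_prop
  have hBc : Continuous B := by fun_prop
  have hpi : -Real.pi ≤ Real.pi := by linarith [Real.pi_pos]
  set S : Set (ℝ × ℝ) := Ioc 0 ρ ×ˢ Ioc (-Real.pi) Real.pi with hS
  have hSc : S ⊆ Icc 0 ρ ×ˢ Icc (-Real.pi) Real.pi := prod_mono Ioc_subset_Icc_self Ioc_subset_Icc_self
  have hint : ∀ {f : ℝ × ℝ → ℂ}, Continuous f → IntegrableOn f S := fun hf =>
    (hf.continuousOn.integrableOn_compact (isCompact_Icc.prod isCompact_Icc)).mono_set hSc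
  have hIA : ∫ p in S, A p = (∫ θ in (-Real.pi)..Real.pi, g (ρ * unitCircle θ)) -
      2 * Real.pi * g 0 := by
    have h1 : ∫ p in S, A p = ∫ θ in Ioc (-Real.pi) Real.pi, ∫ r in Ioc 0 ρ, A (r, θ) := by
      rw [hS, Measure.volume_eq_prod, ← setIntegral_prod_swap]
      rw [setIntegral_prod]
      · rfl
      · exact (((hAc.comp continuous_swap).continuousOn).integrableOn_compact
          (isCompact_Icc.prod isCompact_Icc)).mono_set
          (prod_mono Ioc_subset_Icc_self Ioc_subset_Icc_self)
    rw [h1, ← intervalIntegral.integral_of_le hpi]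
    simp only [← intervalIntegral.integral_of_le hρ, hA, integral_radial_derivative hg]
    rw [intervalIntegral.integral_sub]
    · rw [intervalIntegral.integral_const, Complex.real_smul]
      push_cast
      ring
    · exact (hg.continuous.comp (continuous_const.mul hu)).intervalIntegrable _ _
    · exact intervalIntegrable_const
  have hIB : ∫ p in S, B p = 0 := by
    have h1 : ∫ p in S, B p = ∫ r in Ioc 0 ρ, ∫ θ in Ioc (-Real.pi) Real.pi, B (r, θ) := by
      rw [hS, Measure.volume_eq_prod, setIntegral_prod]
      exact hint hBc
    rw [h1]
    refine setIntegral_eq_zero_of_forall_eq_zero fun r hr => ?_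
    rw [← intervalIntegral.integral_of_le hpi]
    exact integral_angular_derivative hg hr.1.ne'
  have hpolar : ∀ p : ℝ × ℝ, Complex.polarCoord.symm p = p.1 * unitCircle p.2 := by
    intro p
    rw [Complex.polarCoord_symm_apply, unitCircle, Complex.exp_mul_I]
    simp
  rw [← Complex.integral_comp_polarCoord_symm]
  have hS' : ∫ p in polarCoord.target, p.1 • (dbar g (Complex.polarCoord.symm p) /
      Complex.polarCoord.symm p) = ∫ p in S, (1 / 2) * (A p + Complex.I * B p) := by
    -- The polar chart uses an open angular interval, interval integrals a half-open one; the
    -- difference is null.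
    have hae : (Ioc 0 ρ ×ˢ Ioo (-Real.pi) Real.pi : Set (ℝ × ℝ)) =ᵐ[volume] S := by
      rw [hS, Measure.volume_eq_prod]
      exact Measure.set_prod_ae_eq (ae_eq_refl _) Ioo_ae_eq_Ioc
    rw [← setIntegral_congr_set hae]
    have hsub : (Ioc 0 ρ ×ˢ Ioo (-Real.pi) Real.pi : Set (ℝ × ℝ)) ⊆ polarCoord.target :=
      prod_mono Ioc_subset_Ioi_self subset_rfl
    rw [setIntegral_eq_of_subset_of_forall_sdiff_eq_zero polarCoord.open_target.measurableSet hsub]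
    · refine setIntegral_congr_fun (measurableSet_Ioc.prod measurableSet_Ioo) fun p hp => ?_
      have hp0 : p.1 ≠ 0 := hp.1.1.ne'
      simp only [hpolar]
      exact dbar_mul_inv_eq g hp0 p.2
    · rintro p ⟨hp, hp'⟩
      have h1 : ρ ≤ p.1 := by
        by_contra! hlt
        exact hp' ⟨⟨hp.1, hlt.le⟩, hp.2⟩
      rw [h0 _ (by rw [Complex.norm_polarCoord_symm]; exact h1.trans (le_abs_self _))]
      simp
  rw [hS', integral_const_mul, integral_add (hint hAc) ((hint hBc).const_mul _),
    integral_const_mul, hIA, hIB]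
  ring

/-- The Cauchy–Pompeiu formula for a function which is holomorphic outside a disk. -/
theorem integral_dbar_div_sub {g : ℂ → ℂ} (hg : ContDiff ℝ 1 g) (z : ℂ) {ρ : ℝ} (hρ : 0 ≤ ρ)
    (h0 : ∀ w, ρ ≤ ‖w - z‖ → dbar g w = 0) :
    ∫ w, dbar g w / (w - z) =
      (1 / 2) * (∫ θ in (-Real.pi)..Real.pi, g (ρ * unitCircle θ + z)) - Real.pi * g z := by
  have h := integral_dbar_div (g := fun u => g (u + z)) (by fun_prop) hρ (fun w hw => by
    rw [dbar_comp_add]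
    exact h0 _ (by simpa using hw))
  rw [← integral_add_right_eq_self _ z]
  simpa [dbar_comp_add] using h

/-- A bounded function, holomorphic outside a compact set, is the Cauchy transform of its
`∂̄`-derivative, up to its value at infinity. -/
theorem integral_dbar_div_sub_of_tendsto {g : ℂ → ℂ} (hg : ContDiff ℝ 1 g) {R : ℝ}
    (h0 : ∀ w, R ≤ ‖w‖ → dbar g w = 0) {c : ℂ} (hc : Tendsto g (cobounded ℂ) (𝓝 c)) (z : ℂ) :
    ∫ w, dbar g w / (z - w) = Real.pi * (g z - c) := by
  have hnorm : ∀ θ, ‖unitCircle θ‖ = 1 := fun θ => Complex.norm_exp_ofReal_mul_I θ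
  have key : Tendsto (fun ρ : ℝ => ∫ θ in (-Real.pi)..Real.pi, g (ρ * unitCircle θ + z)) atTop
      (𝓝 (∫ θ in (-Real.pi)..Real.pi, c)) := by
    have hev : ∀ᶠ w in cobounded ℂ, ‖g w‖ ≤ ‖c‖ + 1 := by
      filter_upwards [hc.norm.eventually (gt_mem_nhds (lt_add_one ‖c‖))] with w hw using hw.le
    obtain ⟨T, -, hT⟩ := hasBasis_cobounded_norm.eventually_iff.1 hev
    have hge : ∀ (ρ θ : ℝ), ρ - ‖z‖ ≤ ‖ρ * unitCircle θ + z‖ := by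
      intro ρ θ
      have h1 : ‖(ρ : ℂ) * unitCircle θ‖ ≤ ‖ρ * unitCircle θ + z‖ + ‖z‖ := by
        simpa using norm_sub_le ((ρ : ℂ) * unitCircle θ + z) z
      rw [norm_mul, hnorm, mul_one, Complex.norm_real] at h1
      linarith [Real.le_norm_self ρ]
    refine intervalIntegral.tendsto_integral_filter_of_dominated_convergence (fun _ => ‖c‖ + 1)
      ?_ ?_ ?_ ?_
    · refine Eventually.of_forall fun ρ => ?_
      exact (hg.continuous.comp ((continuous_const.mul continuous_unitCircle).add
        continuous_const)).aestronglyMeasurable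
    · filter_upwards [eventually_ge_atTop (T + ‖z‖)] with ρ hρ
      refine Eventually.of_forall fun θ _ => hT ?_
      show T ≤ _
      linarith [hge ρ θ]
    · exact intervalIntegrable_const
    · refine Eventually.of_forall fun θ _ => hc.comp ?_
      rw [← tendsto_norm_atTop_iff_cobounded]
      exact tendsto_atTop_mono (fun ρ => hge ρ θ) (tendsto_atTop_add_const_right _ _ tendsto_id)
  have h1 : (fun ρ : ℝ => (1 / 2 : ℂ) * (∫ θ in (-Real.pi)..Real.pi, g (ρ * unitCircle θ + z)) -
      Real.pi * g z) =ᶠ[atTop] fun _ => ∫ w, dbar g w / (w - z) := by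
    filter_upwards [eventually_ge_atTop (max 0 (R + ‖z‖))] with ρ hρ
    refine (integral_dbar_div_sub hg z ((le_max_left _ _).trans hρ) fun w hw => h0 w ?_).symm
    have := norm_sub_le w z
    linarith [(le_max_right _ _).trans hρ]
  -- The integral does not depend on ρ once the circle about z encloses the support of ∂̄g, so it
  -- equals the limit of the right side as ρ → ∞.
  have h2 := tendsto_nhds_unique (tendsto_const_nhds.congr' h1.symm)
    ((key.const_mul (1 / 2 : ℂ)).sub_const (Real.pi * g z))
  have h3 : ∀ w, dbar g w / (z - w) = -(dbar g w / (w - z)) := fun w => by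
    rw [← neg_sub w z, div_neg]
  simp only [h3]
  rw [integral_neg, h2, intervalIntegral.integral_const]
  simp
  ring

/-! ### Rational competitors -/

/-- Divided by B, the rational function is a competitor for the disks, with value c/B and derivative
(∑ a j)/B at infinity. -/
theorem norm_sum_le_mul_gamma {Z : Finset ℂ} {a : ℂ → ℂ} {c : ℂ} {r B : ℝ} (hr : 0 < r)
    (hB : 0 < B) (hc : ‖c‖ ≤ B)
    (hb : ∀ z, (∀ j ∈ Z, r < dist z j) → ‖c + ∑ j ∈ Z, a j / (z - j)‖ ≤ B) :
    ‖∑ j ∈ Z, a j‖ ≤ B * gamma (⋃ j ∈ Z, closedBall j r) := by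
  set D : Set ℂ := ⋃ j ∈ Z, closedBall j r with hD
  have hmem : ∀ z ∉ D, ∀ j ∈ Z, r < dist z j := by
    intro z hz j hj
    by_contra! h
    exact hz (mem_biUnion hj h)
  have hbd : IsBounded D := (isBounded_biUnion_finset Z).2 fun j _ => isBounded_closedBall
  let f : OnePoint ℂ → ℂ := fun p =>
    p.elim (c / B) fun z => (c + ∑ j ∈ Z, a j / (z - j)) / B
  have hchart : atInftyChart f = fun w => (c + ∑ j ∈ Z, a j * (w * (1 - j * w)⁻¹)) / B := by
    ext w
    by_cases hw : w = 0
    · rw [hw, atInftyChart_zero]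
      simp [f]
    · rw [atInftyChart_of_ne f hw]
      show (c + ∑ j ∈ Z, a j / (w⁻¹ - j)) / B = _
      congr 2
      refine Finset.sum_congr rfl fun j _ => ?_
      have : w⁻¹ - j = w⁻¹ * (1 - j * w) := by field_simp
      rw [this, div_eq_mul_inv, mul_inv, inv_inv]
  have hder : HasDerivAtInfty f ((∑ j ∈ Z, a j) / B) := by
    rw [hasDerivAtInfty_iff, hchart]
    refine HasDerivAt.div_const (HasDerivAt.const_add _ (HasDerivAt.fun_sum fun j _ => ?_)) _
    have h1 : HasDerivAt (fun w : ℂ => 1 - j * w) (-(j * 1)) 0 :=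
      ((hasDerivAt_id (0 : ℂ)).const_mul j).const_sub 1
    have h2 := ((hasDerivAt_id (0 : ℂ)).mul (h1.fun_inv (by simp))).const_mul (a j)
    simpa using h2
  have han : IsAnalyticOff D f := by
    refine ⟨fun z hz => ?_, ?_⟩
    · show AnalyticAt ℂ (fun z : ℂ => (c + ∑ j ∈ Z, a j / (z - j)) / B) z
      refine AnalyticAt.div_const (AnalyticAt.add analyticAt_const
        (Finset.analyticAt_fun_sum _ fun j hj => ?_))
      refine analyticAt_const.fun_div (analyticAt_id.sub analyticAt_const) ?_
      have := hr.trans (hmem z hz j hj)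
      exact sub_ne_zero.2 (dist_pos.1 this)
    · rw [hchart]
      refine AnalyticAt.div_const (AnalyticAt.add analyticAt_const
        (Finset.analyticAt_fun_sum _ fun j hj => ?_))
      refine analyticAt_const.fun_mul (analyticAt_id.fun_mul (AnalyticAt.fun_inv ?_ (by simp)))
      exact analyticAt_const.fun_sub (analyticAt_const.fun_mul analyticAt_id)
  have hbound : ∀ p ∈ sphereCompl D, ‖f p‖ ≤ 1 := by
    have hBn : ‖(B : ℂ)‖ = B := by simp [abs_of_pos hB]
    intro p hp
    induction p using OnePoint.rec with
    | infty =>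
      show ‖c / B‖ ≤ 1
      rw [norm_div, hBn]
      exact (div_le_one hB).2 hc
    | coe z =>
      show ‖(c + ∑ j ∈ Z, a j / (z - j)) / B‖ ≤ 1
      rw [norm_div, hBn]
      exact (div_le_one hB).2 (hb z (hmem z (coe_mem_sphereCompl.1 hp)))
  have h := norm_le_gamma hbd han hbound hder
  rw [norm_div, Complex.norm_real, Real.norm_of_nonneg hB.le, div_le_iff₀ hB] at h
  linarith

/-! ### Representation of a competitor by a compactly supported density -/

/-- Multiply `f` by a cutoff vanishing on the δ/2-thickening and equal to 1 off the δ-thickening: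
this erases the arbitrary values on K and confines ∂̄ to a neighbourhood of K. -/
theorem exists_smooth_extension {K : Set ℂ} {δ : ℝ} (hδ : 0 < δ)
    {f : OnePoint ℂ → ℂ} (hf : IsAnalyticOff K f) (hb : ∀ p ∈ sphereCompl K, ‖f p‖ ≤ 1) :
    ∃ g : ℂ → ℂ, ContDiff ℝ 1 g ∧ (∀ z, ‖g z‖ ≤ 1) ∧ (∀ z, dbar g z ≠ 0 → z ∈ cthickening δ K) ∧
      ∀ z ∉ cthickening δ K, g z = f z := by
  obtain ⟨φ, hφ0, hφ1, hφ⟩ := exists_contMDiffMap_zero_one_of_isClosed (n := 1)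
    (modelWithCornersSelf ℝ ℂ) (isClosed_cthickening (δ := δ / 2) (E := K))
    (isOpen_thickening (δ := δ) (E := K)).isClosed_compl
    (disjoint_compl_right_iff_subset.2 (cthickening_subset_thickening' hδ (half_lt_self hδ) K))
  have hφc : ContDiff ℝ 1 φ := by
    exact_mod_cast φ.contMDiff.contDiff
  have hfar : ∀ z ∉ cthickening δ K, (fun w : ℂ => (φ w : ℂ) * f w) =ᶠ[𝓝 z] fun w => f w := by
    intro z hz
    filter_upwards [isClosed_cthickening.isOpen_compl.mem_nhds hz] with w hw
    have : φ w = 1 := hφ1 fun h => hw (thickening_subset_cthickening δ K h)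
    simp [this]
  have hnot : ∀ z ∉ cthickening δ K, z ∈ Kᶜ := fun z hz h => hz (self_subset_cthickening K h)
  refine ⟨fun w => (φ w : ℂ) * f w, contDiff_iff_contDiffAt.2 fun z => ?_, fun z => ?_,
    fun z hz => ?_, fun z hz => (hfar z hz).self_of_nhds⟩
  · by_cases hz : z ∈ K
    · have : (fun w : ℂ => (φ w : ℂ) * f w) =ᶠ[𝓝 z] fun _ => 0 := by
        filter_upwards [isOpen_thickening.mem_nhds (self_subset_thickening (half_pos hδ) K hz)]
          with w hw
        have : φ w = 0 := hφ0 (thickening_subset_cthickening _ K hw)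
        simp [this]
      exact contDiffAt_const.congr_of_eventuallyEq this
    · exact (Complex.ofRealCLM.contDiff.comp hφc).contDiffAt.mul
        ((hf.1 z hz).contDiffAt.restrict_scalars ℝ)
  · by_cases hz : z ∈ K
    · have : φ z = 0 := hφ0 (self_subset_cthickening K hz)
      simp [this]
    · have h1 := hb _ (coe_mem_sphereCompl.2 hz)
      have h2 : ‖(φ z : ℂ)‖ ≤ 1 := by
        rw [Complex.norm_real, Real.norm_of_nonneg (hφ z).1]
        exact (hφ z).2
      rw [norm_mul]
      exact mul_le_one₀ h2 (norm_nonneg _) h1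
  · by_contra h
    refine hz (dbar_eq_zero_of_differentiableAt ?_)
    exact ((hf.1 z (hnot z h)).differentiableAt).congr_of_eventuallyEq (hfar z h)

theorem HasDerivAtInfty.tendsto {f : OnePoint ℂ → ℂ} {a : ℂ} (h : HasDerivAtInfty f a) :
    Tendsto (fun z : ℂ => f z) (cobounded ℂ) (𝓝 (f ∞)) := by
  have h1 := (tendsto_inv₀_cobounded (α := ℂ)).mul h
  rw [zero_mul] at h1
  have h2 := h1.add_const (f ∞)
  rw [zero_add] at h2
  refine h2.congr' ?_
  filter_upwards [hasBasis_cobounded_norm.mem_of_mem (i := 1) trivial] with z hz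
  have hz0 : z ≠ 0 := by
    rintro rfl
    norm_num at hz
  simp only [inv_mul_cancel_left₀ hz0, sub_add_cancel]

/-- The kernel n/(n - w) tends to 1 and is at most 2 on the support once n ≥ 2R. This identifies the
total mass with the derivative at infinity of the Cauchy transform. -/
theorem tendsto_mul_integral_div_sub {h : ℂ → ℂ} (hc : Continuous h) (hs : HasCompactSupport h) :
    Tendsto (fun n : ℕ => (n : ℂ) * ∫ w, h w / ((n : ℂ) - w)) atTop (𝓝 (∫ w, h w)) := by
  obtain ⟨R, hR, hsub⟩ := (hs.isCompact.isBounded).subset_closedBall_lt 0 0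
  simp_rw [← integral_const_mul]
  refine tendsto_integral_filter_of_dominated_convergence (fun w => 2 * ‖h w‖) ?_ ?_ ?_ ?_
  · refine Eventually.of_forall fun n => Measurable.aestronglyMeasurable ?_
    have := hc.measurable
    fun_prop
  · filter_upwards [tendsto_natCast_atTop_atTop.eventually_ge_atTop (2 * R)] with n hn
    refine Eventually.of_forall fun w => ?_
    by_cases hw : h w = 0
    · simp [hw]
    · have hwR : ‖w‖ ≤ R := by simpa using hsub (subset_tsupport h hw)
      have h1 : (n : ℝ) / 2 ≤ ‖(n : ℂ) - w‖ := by
        have := norm_sub_norm_le (n : ℂ) w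
        rw [Complex.norm_natCast] at this
        linarith
      have h2 : 0 < (n : ℝ) / 2 := by linarith
      rw [norm_mul, norm_div, Complex.norm_natCast, mul_div_assoc', div_le_iff₀ (h2.trans_le h1)]
      nlinarith [norm_nonneg (h w)]
  · exact (hc.norm.integrable_of_hasCompactSupport hs.norm).const_mul 2
  · refine Eventually.of_forall fun w => ?_
    have h1 : Tendsto (fun n : ℕ => (n : ℂ) / ((n : ℂ) + (-w))) atTop (𝓝 1) :=
      tendsto_natCast_div_add_atTop (-w)
    have h2 := h1.mul_const (h w)
    rw [one_mul] at h2
    refine h2.congr fun n => ?_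
    rw [sub_eq_add_neg]
    ring

/-- Every competitor for a compact set is represented, up to a bounded function, by a continuous
density supported near the set. -/
theorem exists_density {K : Set ℂ} (hK : IsCompact K) {δ : ℝ} (hδ : 0 < δ)
    {f : OnePoint ℂ → ℂ} {a : ℂ} (hf : IsAnalyticOff K f) (hb : ∀ p ∈ sphereCompl K, ‖f p‖ ≤ 1)
    (ha : HasDerivAtInfty f a) :
    ∃ (h g : ℂ → ℂ) (c : ℂ), Continuous h ∧ HasCompactSupport h ∧
      (∀ z, h z ≠ 0 → z ∈ cthickening δ K) ∧ (∀ z, ‖g z‖ ≤ 1) ∧ ‖c‖ ≤ 1 ∧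
      (∀ z, ∫ w, h w / (z - w) = Real.pi * (g z - c)) ∧ ∫ w, h w = Real.pi * a := by
  obtain ⟨g, hg, hg1, hsupp, hfar⟩ := exists_smooth_extension hδ hf hb
  have hKδ : IsCompact (cthickening δ K) := hK.cthickening
  have hs : HasCompactSupport (dbar g) := HasCompactSupport.intro hKδ fun z hz => by
    by_contra h
    exact hz (hsupp z h)
  obtain ⟨R, hR, hsub⟩ := hKδ.isBounded.subset_ball_lt 0 0
  have hout : ∀ z : ℂ, R ≤ ‖z‖ → z ∉ cthickening δ K := fun z hz h => by
    have := hsub h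
    rw [mem_ball_zero_iff] at this
    linarith
  have hev : ∀ᶠ z in cobounded ℂ, g z = f z :=
    hasBasis_cobounded_norm.eventually_iff.2 ⟨R, trivial, fun z hz => hfar z (hout z hz)⟩
  have hgc : Tendsto g (cobounded ℂ) (𝓝 (f ∞)) :=
    ha.tendsto.congr' (hev.mono fun z hz => hz.symm)
  have hrep := integral_dbar_div_sub_of_tendsto hg (R := R) (fun w hw => by
    by_contra h
    exact hout w hw (hsupp w h)) hgc
  refine ⟨dbar g, g, f ∞, continuous_dbar hg, hs, hsupp, hg1, hb _ (infty_mem_sphereCompl K),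
    hrep, ?_⟩
  refine tendsto_nhds_unique (tendsto_mul_integral_div_sub (continuous_dbar hg) hs) ?_
  have hn : Tendsto (fun n : ℕ => (n : ℂ)) atTop (cobounded ℂ) := by
    rw [← tendsto_norm_atTop_iff_cobounded]
    simpa using tendsto_natCast_atTop_atTop (R := ℝ)
  refine ((ha.comp hn).const_mul (Real.pi : ℂ)).congr' ?_
  filter_upwards [hn.eventually hev] with n hn
  simp only [Function.comp, hrep, hn]
  ring

/-! ### Discretization of the Cauchy transform -/

/-- The lower left corner of the square of side `s` containing `w`, in the grid `s ℤ[i]`. -/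
def gridPoint (s : ℝ) (w : ℂ) : ℂ := ⟨s * ⌊w.re / s⌋, s * ⌊w.im / s⌋⟩

theorem measurable_gridPoint (s : ℝ) : Measurable (gridPoint s) := by
  have : gridPoint s = fun w => ((s * (⌊w.re / s⌋ : ℝ) : ℝ) : ℂ) +
      ((s * (⌊w.im / s⌋ : ℝ) : ℝ) : ℂ) * Complex.I := by
    ext w
    exact Complex.mk_eq_add_mul_I _ _
  rw [this]
  fun_prop

theorem abs_mul_floor_div_sub_le {s : ℝ} (hs : 0 < s) (x : ℝ) : |s * ⌊x / s⌋ - x| ≤ s := by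
  have h1 := Int.floor_le (x / s)
  have h2 := (Int.lt_floor_add_one (x / s)).le
  rw [le_div_iff₀ hs] at h1
  rw [div_le_iff₀ hs] at h2
  rw [abs_le]
  constructor <;> nlinarith

theorem norm_gridPoint_sub_le {s : ℝ} (hs : 0 < s) (w : ℂ) : ‖gridPoint s w - w‖ ≤ 2 * s := by
  refine (Complex.norm_le_abs_re_add_abs_im _).trans ?_
  have h1 := abs_mul_floor_div_sub_le hs w.re
  have h2 := abs_mul_floor_div_sub_le hs w.im
  simp only [gridPoint, Complex.sub_re, Complex.sub_im]
  linarith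

theorem le_abs_mul_intCast_sub {s : ℝ} (hs : 0 < s) {m n : ℤ} (h : m ≠ n) :
    s ≤ |s * m - s * n| := by
  rw [← mul_sub, abs_mul, abs_of_pos hs]
  have : (1 : ℝ) ≤ |(m : ℝ) - n| := by exact_mod_cast Int.one_le_abs (sub_ne_zero.2 h)
  nlinarith

theorem le_dist_gridPoint {s : ℝ} (hs : 0 < s) {v w : ℂ} (h : gridPoint s v ≠ gridPoint s w) :
    s ≤ dist (gridPoint s v) (gridPoint s w) := by
  rw [dist_eq_norm]
  by_cases hre : ⌊v.re / s⌋ = ⌊w.re / s⌋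
  · have him : ⌊v.im / s⌋ ≠ ⌊w.im / s⌋ := fun him => h (by simp [gridPoint, hre, him])
    exact (le_abs_mul_intCast_sub hs him).trans
      (Complex.abs_im_le_norm (gridPoint s v - gridPoint s w))
  · exact (le_abs_mul_intCast_sub hs hre).trans
      (Complex.abs_re_le_norm (gridPoint s v - gridPoint s w))

theorem finite_gridPoint_image {s : ℝ} (hs : 0 < s) {S : Set ℂ} (hS : IsBounded S) :
    (gridPoint s '' S).Finite := by
  obtain ⟨R, hR⟩ := hS.subset_closedBall 0
  have hfin : ((Icc ⌊-R / s⌋ ⌊R / s⌋ ×ˢ Icc ⌊-R / s⌋ ⌊R / s⌋ : Set (ℤ × ℤ))).Finite :=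
    (finite_Icc _ _).prod (finite_Icc _ _)
  refine (hfin.image fun q : ℤ × ℤ => (⟨s * q.1, s * q.2⟩ : ℂ)).subset ?_
  rintro _ ⟨w, hw, rfl⟩
  have hwR : ‖w‖ ≤ R := by simpa using hR hw
  have hfl : ∀ x : ℝ, |x| ≤ ‖w‖ → ⌊x / s⌋ ∈ Icc ⌊-R / s⌋ ⌊R / s⌋ := by
    intro x hx
    have := abs_le.1 (hx.trans hwR)
    exact ⟨by gcongr; exact this.1, by gcongr; exact this.2⟩
  exact ⟨(⌊w.re / s⌋, ⌊w.im / s⌋), ⟨hfl _ (Complex.abs_re_le_norm w),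
    hfl _ (Complex.abs_im_le_norm w)⟩, rfl⟩

/-- Sum over the fibres of `p`. Taking k = 1 gives the total mass, k = 1/(z - ·) the discretized
Cauchy transform. -/
theorem integral_mul_comp_eq_sum {h : ℂ → ℂ} {p : ℂ → ℂ} (hi : Integrable h)
    (hp : Measurable p) {Z : Finset ℂ} (hZ : ∀ w, h w ≠ 0 → p w ∈ Z) (k : ℂ → ℂ) :
    ∫ w, h w * k (p w) = ∑ j ∈ Z, (∫ w in p ⁻¹' {j}, h w) * k j := by
  have hm : ∀ j, MeasurableSet (p ⁻¹' {j}) := fun j => hp (measurableSet_singleton j)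
  have hcongr : ∀ j, EqOn (fun w => h w * k (p w)) (fun w => h w * k j) (p ⁻¹' {j}) := by
    intro j w hw
    have : p w = j := hw
    simp only [this]
  have h1 : ∫ w, h w * k (p w) = ∫ w in ⋃ j ∈ Z, p ⁻¹' {j}, h w * k (p w) := by
    refine (setIntegral_eq_integral_of_forall_compl_eq_zero fun w hw => ?_).symm
    by_contra hne
    refine hw (mem_biUnion (hZ w fun h0 => hne (by simp [h0])) rfl)
  rw [h1, integral_biUnion_finset Z (fun j _ => hm j)]
  · refine Finset.sum_congr rfl fun j _ => ?_
    rw [setIntegral_congr_fun (hm j) (hcongr j), integral_mul_const]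
  · intro i _ j _ hij
    exact (disjoint_singleton.2 hij).preimage p
  · intro j _
    exact ((hi.mul_const (k j)).integrableOn).congr_fun (hcongr j).symm (hm j)

/-- Put d = |z - w| and e = |z - p|. The difference is at most 8r|h|/(de); since r ≤ e and d ≤ 9e,
also √(rd) ≤ 3e, which trades 1/e for 3/√(rd). The remaining singularity d^(-3/2) is integrable in
the plane. -/
theorem norm_div_sub_div_le {h z w p : ℂ} {r : ℝ} (hr : 0 < r) (hwp : ‖p - w‖ ≤ 8 * r)
    (hz : r ≤ ‖z - p‖) (hzw : z ≠ w) :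
    ‖h / (z - w) - h / (z - p)‖ ≤ 24 * √r * (‖h‖ * ‖w - z‖ ^ (-(3 / 2) : ℝ)) := by
  have hd : 0 < ‖w - z‖ := norm_pos_iff.2 (sub_ne_zero.2 hzw.symm)
  have he : 0 < ‖z - p‖ := hr.trans_le hz
  set d := ‖w - z‖ with hd_def
  set e := ‖z - p‖ with he_def
  have hde : d ≤ 9 * e := by
    have : d ≤ ‖p - w‖ + e := by
      rw [hd_def, he_def, ← norm_neg (w - z)]
      calc ‖-(w - z)‖ = ‖(p - w) + (z - p)‖ := by congr 1; ring
        _ ≤ _ := norm_add_le _ _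
    linarith
  have hdz : ‖z - w‖ = d := norm_sub_rev _ _
  have h1 : h / (z - w) - h / (z - p) = h * (w - p) / ((z - w) * (z - p)) := by
    have hz1 : z - w ≠ 0 := sub_ne_zero.2 hzw
    have hz2 : z - p ≠ 0 := norm_pos_iff.1 he
    field_simp
    ring
  have hrpow : d ^ (-(3 / 2) : ℝ) = (d * √d)⁻¹ := by
    rw [Real.rpow_neg hd.le, Real.sqrt_eq_rpow]
    congr 1
    rw [← Real.rpow_one_add' hd.le (by norm_num)]
    norm_num
  have hsd : 0 < √d := Real.sqrt_pos.2 hd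
  have hsr : 0 < √r := Real.sqrt_pos.2 hr
  have hsq : √r * √d ≤ 3 * e := by
    rw [← Real.sqrt_mul hr.le]
    refine (Real.sqrt_le_left (by positivity)).2 ?_
    nlinarith
  have hrr : √r * √r = r := Real.mul_self_sqrt hr.le
  rw [h1, norm_div, norm_mul, norm_mul, hdz, ← he_def, hrpow, div_le_iff₀ (by positivity)]
  have h2 : ‖w - p‖ ≤ 8 * r := by rwa [norm_sub_rev]
  have h3 : 24 * √r * (‖h‖ * (d * √d)⁻¹) * (d * e) = ‖h‖ * (24 * √r * e / √d) := by
    field_simp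
  rw [h3]
  gcongr
  rw [le_div_iff₀ hsd]
  calc ‖w - p‖ * √d ≤ 8 * r * √d := by gcongr
    _ = 8 * √r * (√r * √d) := by linear_combination (-(8 * √d)) * hrr
    _ ≤ 8 * √r * (3 * e) := by gcongr
    _ = 24 * √r * e := by ring

/-- Within distance 1 of z bound h by its maximum, elsewhere the kernel by 1; translation invariance
makes the bound uniform in z. -/
theorem exists_integral_bound {h : ℂ → ℂ} (hc : Continuous h) (hs : HasCompactSupport h) :
    ∃ C : ℝ, 0 ≤ C ∧ ∀ z : ℂ, Integrable (fun w => ‖h w‖ * ‖w - z‖ ^ (-(3 / 2) : ℝ)) ∧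
      ∫ w, ‖h w‖ * ‖w - z‖ ^ (-(3 / 2) : ℝ) ≤ C := by
  obtain ⟨M, hM⟩ := hc.bounded_above_of_compact_support hs
  have hM0 : 0 ≤ M := (norm_nonneg _).trans (hM 0)
  set φ : ℂ → ℝ := indicator (ball 0 1) fun w => ‖w‖ ^ (-(3 / 2) : ℝ) with hφ
  have hφi : Integrable φ := by
    refine IntegrableOn.integrable_indicator ?_ measurableSet_ball
    refine integrableOn_ball_of_norm_le_rpow (C := 1) (α := 3 / 2) (by simp) ?_ ?_ ?_
    · rw [Complex.finrank_real_complex]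
      norm_num
    · refine Eventually.of_forall fun w => ?_
      rw [one_mul, Real.norm_of_nonneg (by positivity)]
    · exact (measurable_norm.pow_const _).aestronglyMeasurable
  have hφ0 : ∀ w, 0 ≤ φ w := indicator_nonneg fun w _ => by positivity
  have hhi : Integrable fun w => ‖h w‖ := hc.norm.integrable_of_hasCompactSupport hs.norm
  have hle : ∀ z w, ‖h w‖ * ‖w - z‖ ^ (-(3 / 2) : ℝ) ≤ M * φ (w - z) + ‖h w‖ := by
    intro z w
    by_cases hw : ‖w - z‖ < 1
    · have : φ (w - z) = ‖w - z‖ ^ (-(3 / 2) : ℝ) := indicator_of_mem (by simpa using hw) _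
      rw [this]
      have := hM w
      have h2 : 0 ≤ ‖w - z‖ ^ (-(3 / 2) : ℝ) := by positivity
      nlinarith [norm_nonneg (h w)]
    · have h1 : ‖w - z‖ ^ (-(3 / 2) : ℝ) ≤ 1 :=
        Real.rpow_le_one_of_one_le_of_nonpos (not_lt.1 hw) (by norm_num)
      nlinarith [norm_nonneg (h w), mul_nonneg hM0 (hφ0 (w - z))]
  have hbi : ∀ z, Integrable fun w => M * φ (w - z) + ‖h w‖ := fun z =>
    ((hφi.comp_sub_right z).const_mul M).add hhi
  have hint : ∀ z, Integrable fun w => ‖h w‖ * ‖w - z‖ ^ (-(3 / 2) : ℝ) := by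
    intro z
    refine (hbi z).mono' ?_ (Eventually.of_forall fun w => ?_)
    · have : Measurable fun w : ℂ => ‖w - z‖ ^ (-(3 / 2) : ℝ) :=
        (measurable_id.sub_const z).norm.pow_const _
      exact (hc.norm.measurable.mul this).aestronglyMeasurable
    · rw [Real.norm_of_nonneg (by positivity)]
      exact hle z w
  refine ⟨M * (∫ w, φ w) + ∫ w, ‖h w‖, add_nonneg (mul_nonneg hM0 (integral_nonneg hφ0))
    (integral_nonneg fun w => norm_nonneg _), fun z => ⟨hint z, ?_⟩⟩
  refine (integral_mono (hint z) (hbi z) (hle z)).trans_eq ?_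
  rw [integral_add ((hφi.comp_sub_right z).const_mul M) hhi, integral_const_mul,
    integral_sub_right_eq_self φ z]

/-- Moving the mass of a continuous density by at most `8 r` changes its Cauchy transform by
`O(√r)`, at distance `r` from the displaced mass. -/
theorem exists_norm_integral_sub_le {h : ℂ → ℂ} (hc : Continuous h) (hs : HasCompactSupport h) :
    ∃ C : ℝ, 0 ≤ C ∧ ∀ (r : ℝ) (p : ℂ → ℂ) (z : ℂ), 0 < r → Measurable p →
      (∀ w, ‖p w - w‖ ≤ 8 * r) → (∀ w, h w ≠ 0 → r ≤ ‖z - p w‖) →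
      ‖(∫ w, h w / (z - w)) - ∫ w, h w / (z - p w)‖ ≤ C * √r := by
  obtain ⟨C, hC, hbound⟩ := exists_integral_bound hc hs
  refine ⟨24 * C, by positivity, fun r p z hr hp hpw hz => ?_⟩
  obtain ⟨hi, hle⟩ := hbound z
  have hne : ∀ᵐ w : ℂ, w ≠ z := by simp [ae_iff]
  have hdiff : ∀ᵐ w : ℂ, ‖h w / (z - w) - h w / (z - p w)‖ ≤
      24 * √r * (‖h w‖ * ‖w - z‖ ^ (-(3 / 2) : ℝ)) := by
    filter_upwards [hne] with w hw
    by_cases h0 : h w = 0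
    · simp [h0]
    · exact norm_div_sub_div_le hr (hpw w) (hz w h0) hw.symm
  have hhm := hc.measurable
  have hm1 : Measurable fun w => h w / (z - w) := by fun_prop
  have hm2 : Measurable fun w => h w / (z - p w) := by fun_prop
  have hi2 : Integrable fun w => h w / (z - p w) := by
    refine (((hc.norm.integrable_of_hasCompactSupport hs.norm)).div_const r).mono'
      hm2.aestronglyMeasurable (Eventually.of_forall fun w => ?_)
    by_cases h0 : h w = 0
    · simp [h0]
    · rw [norm_div]
      have := hz w h0
      gcongr
  have hid : Integrable fun w => h w / (z - w) - h w / (z - p w) :=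
    (hi.const_mul (24 * √r)).mono' (hm1.sub hm2).aestronglyMeasurable hdiff
  -- Integrability of the singular integrand is recovered from the difference and the displaced
  -- integrand.
  have hi1 : Integrable fun w => h w / (z - w) := by
    have := hid.add hi2
    refine this.congr (Eventually.of_forall fun w => ?_)
    simp
  rw [← integral_sub hi1 hi2]
  calc _ ≤ ∫ w, 24 * √r * (‖h w‖ * ‖w - z‖ ^ (-(3 / 2) : ℝ)) :=
        norm_integral_le_of_norm_le (hi.const_mul _) hdiff
    _ = 24 * √r * ∫ w, ‖h w‖ * ‖w - z‖ ^ (-(3 / 2) : ℝ) := integral_const_mul _ _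
    _ ≤ 24 * √r * C := by gcongr
    _ = 24 * C * √r := by ring

/-- The analytic capacity of a compact set is approximated from below by that of finite disjoint
unions of small disks of equal radius near the set. -/
theorem exists_disks {K : Set ℂ} (hK : IsCompact K) {δ η t : ℝ} (hδ : 0 < δ) (hη : 0 < η)
    (ht : t ∈ competitorValues K) :
    ∃ (r : ℝ) (Z : Finset ℂ), 0 < r ∧
      (Z : Set ℂ).PairwiseDisjoint (fun z => closedBall z r) ∧
      (∀ j ∈ Z, ∃ x ∈ K, dist j x + r ≤ δ) ∧
      t ≤ (1 + η) * gamma (⋃ z ∈ Z, closedBall z r) := by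
  obtain ⟨f, a, hf, hb, ha, rfl⟩ := ht
  obtain ⟨h, g, c, hc, hs, hsupp, hg, hc1, hrep, hint⟩ := exists_density hK (half_pos hδ) hf hb ha
  obtain ⟨C, hC, hCb⟩ := exists_norm_integral_sub_le hc hs
  -- The density lives within δ/2 of K; a displacement of 8r and a radius r add 9r.
  have hev : ∀ᶠ r in 𝓝[>] (0 : ℝ), C * √r < η ∧ 9 * r < δ / 2 := by
    refine Eventually.and ?_ ?_
    · have : Tendsto (fun r : ℝ => C * √r) (𝓝 0) (𝓝 (C * √0)) :=
        (continuous_const.mul Real.continuous_sqrt).tendsto 0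
      rw [Real.sqrt_zero, mul_zero] at this
      exact (this.mono_left nhdsWithin_le_nhds).eventually (gt_mem_nhds hη)
    · have : Tendsto (fun r : ℝ => 9 * r) (𝓝 0) (𝓝 (9 * 0)) :=
        (continuous_const.mul continuous_id).tendsto 0
      rw [mul_zero] at this
      exact (this.mono_left nhdsWithin_le_nhds).eventually (gt_mem_nhds (half_pos hδ))
  obtain ⟨r, ⟨hrη, hrδ⟩, hr⟩ := (hev.and self_mem_nhdsWithin).exists
  -- Mesh 4r separates the centres by more than 2r, so the disks are disjoint.
  have hs4 : 0 < 4 * r := by positivity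
  set p := gridPoint (4 * r) with hp
  have hpm : Measurable p := measurable_gridPoint _
  have hpw : ∀ w, ‖p w - w‖ ≤ 8 * r := fun w =>
    (norm_gridPoint_sub_le hs4 w).trans_eq (by ring)
  have hfin : (p '' Function.support h).Finite :=
    finite_gridPoint_image hs4 (hs.isCompact.isBounded.subset (subset_tsupport h))
  have hZ : ∀ w, h w ≠ 0 → p w ∈ hfin.toFinset := fun w hw =>
    hfin.mem_toFinset.2 (mem_image_of_mem p hw)
  have hsum := integral_mul_comp_eq_sum (hc.integrable_of_hasCompactSupport hs) hpm hZ
  refine ⟨r, hfin.toFinset, hr, ?_, ?_, ?_⟩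
  · intro i hi j hj hij
    rw [hfin.coe_toFinset] at hi hj
    obtain ⟨v, -, rfl⟩ := hi
    obtain ⟨w, -, rfl⟩ := hj
    refine closedBall_disjoint_closedBall ?_
    have := le_dist_gridPoint hs4 hij
    linarith
  · intro j hj
    obtain ⟨w, hw, rfl⟩ := hfin.mem_toFinset.1 hj
    have h1 := hsupp w hw
    rw [hK.cthickening_eq_biUnion_closedBall (half_pos hδ).le] at h1
    obtain ⟨x, hx, hwx⟩ := mem_iUnion₂.1 h1
    refine ⟨x, hx, ?_⟩
    have h2 := dist_triangle (p w) w x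
    rw [dist_eq_norm (p w) w] at h2
    have h3 := hpw w
    rw [mem_closedBall] at hwx
    linarith
  · have hpi : (Real.pi : ℂ) ≠ 0 := Complex.ofReal_ne_zero.2 Real.pi_ne_zero
    have htot : a = ∑ j ∈ hfin.toFinset, (∫ w in p ⁻¹' {j}, h w) / Real.pi := by
      have := hsum fun _ => 1
      simp only [mul_one] at this
      rw [← Finset.sum_div, ← this, hint, mul_div_cancel_left₀ _ hpi]
    rw [htot]
    refine norm_sum_le_mul_gamma (c := c) hr (by positivity) (hc1.trans (by linarith))
      fun z hz => ?_
    have h1 : ∑ j ∈ hfin.toFinset, (∫ w in p ⁻¹' {j}, h w) / Real.pi / (z - j) =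
        (∫ w, h w / (z - p w)) / Real.pi := by
      have := hsum fun j => (z - j)⁻¹
      simp only [← div_eq_mul_inv] at this
      rw [this, Finset.sum_div]
      exact Finset.sum_congr rfl fun j _ => div_right_comm _ _ _
    have h2 := hCb r p z hr hpm hpw fun w hw => by
      have := hz _ (hZ w hw)
      rw [dist_eq_norm] at this
      exact this.le
    -- The rational function is g, bounded by 1, minus the discretization error.
    have h3 : c + (∫ w, h w / (z - p w)) / Real.pi =
        g z - ((∫ w, h w / (z - w)) - ∫ w, h w / (z - p w)) / Real.pi := by
      rw [hrep]
      field_simp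
      ring
    rw [h1, h3]
    refine (norm_sub_le _ _).trans (add_le_add (hg z) ?_)
    rw [norm_div, Complex.norm_real, Real.norm_of_nonneg Real.pi_pos.le,
      div_le_iff₀ Real.pi_pos]
    have h4 : (1 : ℝ) ≤ Real.pi := by linarith [Real.pi_gt_three]
    nlinarith

/-! ### Reduction of subadditivity to disks -/

theorem IsFiniteUnionOfDisks.isCompact {r : ℝ} {E : Set ℂ} (h : IsFiniteUnionOfDisks r E) :
    IsCompact E := by
  obtain ⟨Z, -, rfl⟩ := h
  exact Z.isCompact_biUnion fun z _ => isCompact_closedBall z r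

open scoped Classical in
/-- Subadditivity for disjoint finite unions of disks of equal radius implies subadditivity. -/
theorem gamma_union_le_of_disks
    (h : ∀ (r : ℝ) (E F : Set ℂ), 0 < r → IsFiniteUnionOfDisks r E → IsFiniteUnionOfDisks r F →
      Disjoint E F → gamma (E ∪ F) ≤ gamma E + gamma F)
    {E F : Set ℂ} (hE : IsCompact E) (hF : IsCompact F) :
    gamma (E ∪ F) ≤ gamma E + gamma F := by
  have key : ∀ ε > 0, gamma (E ∪ F) ≤ (1 + ε) * (gamma E + gamma F + 2 * ε) + ε := by
    intro ε hε
    obtain ⟨δ₁, hδ₁, h1⟩ := exists_gamma_cthickening_le hE hε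
    obtain ⟨δ₂, hδ₂, h2⟩ := exists_gamma_cthickening_le hF hε
    obtain ⟨t, ht, htlt⟩ := exists_lt_of_lt_csSup (competitorValues_nonempty (E ∪ F))
      (show gamma (E ∪ F) - ε < sSup (competitorValues (E ∪ F)) from sub_lt_self _ hε)
    obtain ⟨r, Z, hr, hdisj, hnear, hle⟩ :=
      exists_disks (hE.union hF) (lt_min hδ₁ hδ₂) hε ht
    -- Disks near E, even those also near F, go to the first family; `hnear` puts all others near F.
    set P : ℂ → Prop := fun j => ∃ x ∈ E, dist j x + r ≤ min δ₁ δ₂ with hP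
    have hsplit : (⋃ z ∈ Z, closedBall z r) = (⋃ z ∈ Z.filter P, closedBall z r) ∪
        ⋃ z ∈ Z.filter (fun j => ¬ P j), closedBall z r := by
      rw [← Finset.set_biUnion_union, Finset.filter_union_filter_not_eq]
    have hsub : ∀ {G : Set ℂ} {δ : ℝ} {j : ℂ}, min δ₁ δ₂ ≤ δ →
        (∃ x ∈ G, dist j x + r ≤ min δ₁ δ₂) → closedBall j r ⊆ cthickening δ G := by
      rintro G δ j hδ ⟨x, hx, hjx⟩ y hy
      refine mem_cthickening_of_dist_le y x δ G hx ?_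
      have := dist_triangle y j x
      rw [mem_closedBall] at hy
      linarith
    have hE' : (⋃ z ∈ Z.filter P, closedBall z r) ⊆ cthickening δ₁ E :=
      iUnion₂_subset fun j hj => hsub (min_le_left _ _) (Finset.mem_filter.1 hj).2
    have hF' : (⋃ z ∈ Z.filter (fun j => ¬ P j), closedBall z r) ⊆ cthickening δ₂ F := by
      refine iUnion₂_subset fun j hj => hsub (min_le_right _ _) ?_
      obtain ⟨hjZ, hjP⟩ := Finset.mem_filter.1 hj
      obtain ⟨x, hx, hjx⟩ := hnear j hjZ
      exact ⟨x, hx.resolve_left fun hxE => hjP ⟨x, hxE, hjx⟩, hjx⟩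
    have hsubadd := h r _ _ hr
      ⟨Z.filter P, hdisj.subset (Finset.coe_subset.2 (Finset.filter_subset _ _)), rfl⟩
      ⟨Z.filter (fun j => ¬ P j),
        hdisj.subset (Finset.coe_subset.2 (Finset.filter_subset _ _)), rfl⟩ (by
        refine disjoint_iUnion₂_left.2 fun i hi => disjoint_iUnion₂_right.2 fun j hj => ?_
        obtain ⟨hiZ, hiP⟩ := Finset.mem_filter.1 hi
        obtain ⟨hjZ, hjP⟩ := Finset.mem_filter.1 hj
        exact hdisj hiZ hjZ fun hij => hjP (hij ▸ hiP))
    rw [← hsplit] at hsubadd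
    have h3 := gamma_mono hE' hE.isBounded.cthickening
    have h4 := gamma_mono hF' hF.isBounded.cthickening
    have h5 : (1 + ε) * gamma (⋃ z ∈ Z, closedBall z r) ≤
        (1 + ε) * (gamma E + gamma F + 2 * ε) := by
      gcongr
      linarith
    linarith
  have hlim : Tendsto (fun ε : ℝ => (1 + ε) * (gamma E + gamma F + 2 * ε) + ε) (𝓝[>] 0)
      (𝓝 (gamma E + gamma F)) := by
    have : Continuous fun ε : ℝ => (1 + ε) * (gamma E + gamma F + 2 * ε) + ε := by fun_prop
    simpa using (this.tendsto 0).mono_left (nhdsWithin_le_nhds (s := Ioi (0 : ℝ)))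
  exact ge_of_tendsto hlim (eventually_nhdsWithin_of_forall fun ε hε => key ε hε)

end AnalyticCapacity

end

theorem theorem4p1 :
    (∀ E F : Set ℂ, IsCompact E → IsCompact F →
      AnalyticCapacity.gamma (E ∪ F) ≤ AnalyticCapacity.gamma E + AnalyticCapacity.gamma F) ↔
    (∀ (r : ℝ) (E F : Set ℂ), 0 < r →
      AnalyticCapacity.IsFiniteUnionOfDisks r E → AnalyticCapacity.IsFiniteUnionOfDisks r F →
      Disjoint E F →
      AnalyticCapacity.gamma (E ∪ F) ≤ AnalyticCapacity.gamma E + AnalyticCapacity.gamma F) :=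
  ⟨fun h _ E F _ hE hF _ => h E F hE.isCompact hF.isCompact,
    fun h _ _ hE hF => AnalyticCapacity.gamma_union_le_of_disks h hE hF⟩
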